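/- Let $H$ be a Hilbert module over a $C^*$-algebra, let $\mathcal L(\cdot)$ and $\mathcal L(\cdot,\cdot)$ denote adjointable operators, and let $\mathcal R(\cdot)$, $\mathcal N(\cdot)$ denote ranges and null spaces. Let $P\in\mathcal L(H)$ be a projection with $P\neq 0$, $P\neq I$, and let $Q\in\mathcal L(H)$ be an idempotent such that $(P,Q)$ is a quasi-projection pair, i.e. $PQ^*P=PQP$, $PQ^*(I-P)=-PQ(I-P)$ and $(I-P)Q^*(I-P)=(I-P)Q(I-P)$. Suppose that the pair is harmonious, i.e. $\overline{\mathcal R(PQ(I-P))}$ and $\overline{\mathcal R((I-P)QP)}$ are orthogonally complemented in $H$. Let $U_P:H\to\mathcal R(P)\oplus\mathcal N(P)$, $U_Ph=(Ph,(I-P)h)^T$. Let $$U_PQU_P^*=\begin{pmatrix}A&-\ell(A)U^*\\ U\ell(A)&U(I_{\mathcal R(P)}-A)U^*+Q_0\end{pmatrix}$$ be the canonical $2\times2$ block matrix representation of $Q$ induced by $P$; that is, $A\in\mathcal L(\mathcal R(P))$ is self-adjoint with $A^2-A\ge0$, $\ell(A)=(A^2-A)^{1/2}$, $U\in\mathcal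 L(\mathcal R(P),\mathcal N(P))$ is a partial isometry, and $Q_0\in\mathcal L(\mathcal N(P))$ is a projection such that $\mathcal R(U^*)=\overline{\mathcal R(A^2-A)}$ and $U^*Q_0=0$. Let $$m(Q)=\tfrac12\big(|Q^*|+Q^*\big)|Q^*|^\dagger\big(|Q^*|+I\big)^{-1}\big(|Q^*|+Q\big)$$ be the matched projection of $Q$, where $|T|=(T^*T)^{1/2}$ and $\dagger$ denotes the Moore–Penrose inverse. Then $$U_P\,m(Q)\,U_P^*=\begin{pmatrix}\tfrac12\big(I_{\mathcal R(P)}+f(A)\big)&0\\ 0&\tfrac12U\big(I_{\mathcal R(P)}-f(A)\big)U^*+Q_0\end{pmatrix},$$ where $f(A)$ is defined by the continuous functional calculus with $f(t)=1$ for $t\ge1$ and $f(t)=-1$ for $t\le0$ (the spectrum of $A$ is contained in $(-\infty,0]\cup[1,\infty)$). -/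

import Mathlib

set_option linter.unusedSectionVars false

noncomputable section

/-! Hilbert `C⋆`-modules are Mathlib's `CStarModule`s that are complete.  Mathlib lets the
coefficient algebra act by `a • x` with `⟪x, a • y⟫ = a * ⟪x, y⟫`, so that a right Hilbert module
over `B` is a `CStarModule` over `A = Bᵐᵒᵖ`; as `A` is an arbitrary `C⋆`-algebra, both conventions
describe the same objects and the same adjointable operators. -/

section Adjointable

variable (A : Type*) [NonUnitalCStarAlgebra A] [PartialOrder A] [StarOrderedRing A]
variable (H : Type*) [NormedAddCommGroup H] [NormedSpace ℂ H] [SMul A H] [CStarModule A H]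
variable (K : Type*) [NormedAddCommGroup K] [NormedSpace ℂ K] [SMul A K] [CStarModule A K]
variable (L : Type*) [NormedAddCommGroup L] [NormedSpace ℂ L] [SMul A L] [CStarModule A L]

/-- The adjointable operators, as a subspace of the bounded linear operators. -/
def adjointableSubmodule : Submodule ℂ (H →L[ℂ] K) where
  carrier := {T | ∃ S : K →L[ℂ] H, ∀ x y, inner A (T x) y = inner A x (S y)}
  zero_mem' := ⟨0, fun x y => by simp⟩
  add_mem' := by
    rintro T T' ⟨S, hS⟩ ⟨S', hS'⟩
    exact ⟨S + S', fun x y => by simp [hS, hS']⟩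
  smul_mem' := by
    rintro c T ⟨S, hS⟩
    exact ⟨star c • S, fun x y => by simp [hS]⟩

/-- `L(H, K)`: the space of adjointable operators between Hilbert `C⋆`-modules over `A`. -/
def Adjointable : Type _ := adjointableSubmodule A H K

namespace Adjointable

instance : NormedAddCommGroup (Adjointable A H K) :=
  inferInstanceAs (NormedAddCommGroup (adjointableSubmodule A H K))

instance : NormedSpace ℂ (Adjointable A H K) :=
  inferInstanceAs (NormedSpace ℂ (adjointableSubmodule A H K))

variable {A H K L}

/-- The underlying bounded linear operator. -/
def toCLM (T : Adjointable A H K) : H →L[ℂ] K := Subtype.val T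

theorem toCLM_injective : Function.Injective (toCLM : Adjointable A H K → H →L[ℂ] K) :=
  Subtype.val_injective

instance : FunLike (Adjointable A H K) H K where
  coe T := T.toCLM
  coe_injective := DFunLike.coe_injective.comp toCLM_injective

@[ext]
theorem ext {S T : Adjointable A H K} (h : ∀ x, S x = T x) : S = T := DFunLike.ext _ _ h

@[simp] theorem toCLM_apply (T : Adjointable A H K) (x : H) : T.toCLM x = T x := rfl

theorem norm_def (T : Adjointable A H K) : ‖T‖ = ‖T.toCLM‖ := rfl

/-- Construct an adjointable operator from a bounded operator and its adjoint. -/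
def mk (T : H →L[ℂ] K) (S : K →L[ℂ] H) (h : ∀ x y, inner A (T x) y = inner A x (S y)) :
    Adjointable A H K := ⟨T, S, h⟩

@[simp] theorem mk_apply (T : H →L[ℂ] K) (S : K →L[ℂ] H)
    (h : ∀ x y, inner A (T x) y = inner A x (S y)) (x : H) : mk (A := A) T S h x = T x := rfl

@[simp] theorem zero_apply (x : H) : (0 : Adjointable A H K) x = 0 := rfl
@[simp] theorem add_apply (S T : Adjointable A H K) (x : H) : (S + T) x = S x + T x := rfl
@[simp] theorem sub_apply (S T : Adjointable A H K) (x : H) : (S - T) x = S x - T x := rfl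
@[simp] theorem neg_apply (T : Adjointable A H K) (x : H) : (-T) x = -T x := rfl
@[simp] theorem smul_apply (c : ℂ) (T : Adjointable A H K) (x : H) : (c • T) x = c • T x := rfl

/-- The adjoint operator `T⋆`. -/
def adj (T : Adjointable A H K) : Adjointable A K H :=
  mk (Classical.choose T.2) T.toCLM (fun x y => by
    have h : ∀ x y, inner A (T.toCLM x) y = inner A x (Classical.choose T.2 y) :=
      Classical.choose_spec T.2
    rw [← CStarModule.star_inner, ← h, CStarModule.star_inner])

theorem inner_apply_left (T : Adjointable A H K) (x : H) (y : K) :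
    inner A (T x) y = inner A x (T.adj y) :=
  Classical.choose_spec T.2 x y

theorem inner_apply_right (T : Adjointable A H K) (x : K) (y : H) :
    inner A x (T y) = inner A (T.adj x) y := by
  rw [← CStarModule.star_inner, inner_apply_left, CStarModule.star_inner]

theorem eq_of_inner {x y : H} (h : ∀ z : H, inner A z x = inner A z y) : x = y := by
  have : inner A (x - y) (x - y) = 0 := by
    rw [CStarModule.inner_sub_right, h, sub_self]
  exact sub_eq_zero.mp (CStarModule.inner_self.mp this)

theorem eq_adj {T : Adjointable A H K} {S : Adjointable A K H}
    (h : ∀ x y, inner A (T x) y = inner A x (S y)) : T.adj = S := by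
  ext y
  exact eq_of_inner (A := A) fun z => by rw [← inner_apply_left, h]

@[simp] theorem adj_adj (T : Adjointable A H K) : T.adj.adj = T :=
  eq_adj fun x y => (inner_apply_right T x y).symm

theorem adj_add (S T : Adjointable A H K) : (S + T).adj = S.adj + T.adj :=
  eq_adj fun x y => by simp [inner_apply_left]

theorem adj_sub (S T : Adjointable A H K) : (S - T).adj = S.adj - T.adj :=
  eq_adj fun x y => by simp [inner_apply_left]

theorem adj_smul (c : ℂ) (T : Adjointable A H K) : (c • T).adj = star c • T.adj :=
  eq_adj fun x y => by simp [inner_apply_left]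

theorem norm_adj_le (T : Adjointable A H K) : ‖T.adj‖ ≤ ‖T‖ := by
  refine ContinuousLinearMap.opNorm_le_bound T.adj.toCLM (norm_nonneg T) fun y => ?_
  have h : ‖T.adj y‖ * ‖T.adj y‖ ≤ (‖T‖ * ‖y‖) * ‖T.adj y‖ := by
    calc ‖T.adj y‖ * ‖T.adj y‖ = ‖inner A (T (T.adj y)) y‖ := by
          rw [inner_apply_left, ← CStarModule.norm_sq_eq, sq]
      _ ≤ ‖T (T.adj y)‖ * ‖y‖ := CStarModule.norm_inner_le K
      _ ≤ (‖T‖ * ‖T.adj y‖) * ‖y‖ := by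
          gcongr
          exact T.toCLM.le_opNorm _
      _ = _ := by ring
  rcases eq_or_lt_of_le (norm_nonneg (T.adj y)) with h0 | h0
  · rw [toCLM_apply, ← h0]; positivity
  · exact le_of_mul_le_mul_right h h0

theorem norm_adj (T : Adjointable A H K) : ‖T.adj‖ = ‖T‖ :=
  le_antisymm (norm_adj_le T) (by simpa using norm_adj_le T.adj)

/-- Composition of adjointable operators. -/
def comp (S : Adjointable A K L) (T : Adjointable A H K) : Adjointable A H L :=
  mk (S.toCLM ∘L T.toCLM) (T.adj.toCLM ∘L S.adj.toCLM) fun x y => by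
    simp [inner_apply_left]

@[simp] theorem comp_apply (S : Adjointable A K L) (T : Adjointable A H K) (x : H) :
    S.comp T x = S (T x) := rfl

theorem adj_comp (S : Adjointable A K L) (T : Adjointable A H K) :
    (S.comp T).adj = T.adj.comp S.adj :=
  eq_adj fun x y => by simp [inner_apply_left]

/-! ### The `C⋆`-algebra `L(H)` -/

instance : One (Adjointable A H H) := ⟨mk (.id ℂ H) (.id ℂ H) fun _ _ => rfl⟩

instance : Mul (Adjointable A H H) := ⟨fun S T => S.comp T⟩

instance : Star (Adjointable A H H) := ⟨adj⟩

@[simp] theorem one_apply (x : H) : (1 : Adjointable A H H) x = x := rfl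
@[simp] theorem mul_apply (S T : Adjointable A H H) (x : H) : (S * T) x = S (T x) := rfl
theorem mul_def (S T : Adjointable A H H) : S * T = S.comp T := rfl
theorem star_def (T : Adjointable A H H) : star T = T.adj := rfl

theorem map_add' (T : Adjointable A H K) (x y : H) : T (x + y) = T x + T y := T.toCLM.map_add x y
theorem map_sub' (T : Adjointable A H K) (x y : H) : T (x - y) = T x - T y := T.toCLM.map_sub x y
theorem map_zero' (T : Adjointable A H K) : T 0 = 0 := T.toCLM.map_zero
theorem map_smul' (T : Adjointable A H K) (c : ℂ) (x : H) : T (c • x) = c • T x :=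
  T.toCLM.map_smul c x

instance : NormedRing (Adjointable A H H) where
  __ := (inferInstance : NormedAddCommGroup (Adjointable A H H))
  left_distrib S T U := by ext x; simp [map_add']
  right_distrib S T U := by ext x; simp
  zero_mul T := by ext x; simp
  mul_zero T := by ext x; simp [map_zero']
  mul_assoc S T U := by ext x; simp
  one_mul T := by ext x; simp
  mul_one T := by ext x; simp
  norm_mul_le S T := ContinuousLinearMap.opNorm_comp_le S.toCLM T.toCLM

instance : Algebra ℂ (Adjointable A H H) :=
  Algebra.ofModule (fun c S T => by ext x; simp) (fun c S T => by ext x; simp [map_smul'])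

instance : NormedAlgebra ℂ (Adjointable A H H) where
  norm_smul_le c T := norm_smul_le c T

instance : StarRing (Adjointable A H H) where
  star_involutive T := adj_adj T
  star_mul S T := adj_comp S T
  star_add S T := adj_add S T

instance : StarModule ℂ (Adjointable A H H) where
  star_smul c T := adj_smul c T

instance : CStarRing (Adjointable A H H) where
  norm_mul_self_le T := by
    have hb : ‖T‖ ≤ √‖star T * T‖ := by
      refine ContinuousLinearMap.opNorm_le_bound T.toCLM (Real.sqrt_nonneg _) fun x => ?_
      have h : ‖T x‖ ^ 2 ≤ ‖star T * T‖ * ‖x‖ ^ 2 := by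
        calc ‖T x‖ ^ 2 = ‖inner A x ((star T * T) x)‖ := by
              rw [CStarModule.norm_sq_eq A, inner_apply_left]; rfl
          _ ≤ ‖x‖ * ‖(star T * T) x‖ := CStarModule.norm_inner_le H
          _ ≤ ‖x‖ * (‖star T * T‖ * ‖x‖) := by
              gcongr
              exact (star T * T).toCLM.le_opNorm _
          _ = _ := by ring
      have := Real.sqrt_le_sqrt h
      rwa [Real.sqrt_sq (norm_nonneg _), Real.sqrt_mul (norm_nonneg _),
        Real.sqrt_sq (norm_nonneg _)] at this
    calc ‖T‖ * ‖T‖ ≤ √‖star T * T‖ * √‖star T * T‖ := by gcongr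
      _ = _ := Real.mul_self_sqrt (norm_nonneg _)

instance [CompleteSpace H] : CompleteSpace (Adjointable A H H) := by
  refine Metric.complete_of_cauchySeq_tendsto fun u hu => ?_
  have hT : CauchySeq fun n => (u n).toCLM := by
    rw [Metric.cauchySeq_iff] at hu ⊢
    intro ε hε
    obtain ⟨N, hN⟩ := hu ε hε
    exact ⟨N, fun m hm n hn => hN m hm n hn⟩
  have hS : CauchySeq fun n => (u n).adj.toCLM := by
    rw [Metric.cauchySeq_iff] at hu ⊢
    intro ε hε
    obtain ⟨N, hN⟩ := hu ε hε
    refine ⟨N, fun m hm n hn => ?_⟩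
    have h1 := hN m hm n hn
    rw [dist_eq_norm, ← norm_adj, adj_sub] at h1
    rw [dist_eq_norm]
    exact h1
  obtain ⟨T, hT⟩ := cauchySeq_tendsto_of_complete hT
  obtain ⟨S, hS⟩ := cauchySeq_tendsto_of_complete hS
  have hadj : ∀ x y, inner A (T x) y = inner A x (S y) := by
    intro x y
    have h1 : Filter.Tendsto (fun n => inner A ((u n).toCLM x) y) Filter.atTop
        (nhds (inner A (T x) y)) := by
      have hx := ((ContinuousLinearMap.apply ℂ H x).continuous.tendsto T).comp hT
      exact (CStarModule.continuous_inner (A := A) (E := H)).continuousAt.tendsto.comp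
        (hx.prodMk_nhds tendsto_const_nhds)
    have h2 : Filter.Tendsto (fun n => inner A x ((u n).adj.toCLM y)) Filter.atTop
        (nhds (inner A x (S y))) := by
      have hy := ((ContinuousLinearMap.apply ℂ H y).continuous.tendsto S).comp hS
      exact (CStarModule.continuous_inner (A := A) (E := H)).continuousAt.tendsto.comp
        (tendsto_const_nhds.prodMk_nhds hy)
    refine tendsto_nhds_unique h1 (h2.congr fun n => ?_)
    exact ((u n).inner_apply_left x y).symm
  refine ⟨mk T S hadj, ?_⟩
  rw [tendsto_iff_norm_sub_tendsto_zero] at hT ⊢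
  exact hT

instance [CompleteSpace H] : CStarAlgebra (Adjointable A H H) where

/-- The order of the `C⋆`-algebra `L(H)`: `S ≤ T` iff `T - S` is a positive element. -/
instance [CompleteSpace H] : PartialOrder (Adjointable A H H) := CStarAlgebra.spectralOrder _

instance [CompleteSpace H] : StarOrderedRing (Adjointable A H H) :=
  CStarAlgebra.spectralOrderedRing _

theorem map_op_smul (T : Adjointable A H K) (a : A) (x : H) : T (a • x) = a • T x :=
  eq_of_inner (A := A) fun z => by
    rw [inner_apply_right, CStarModule.inner_op_smul_right, CStarModule.inner_op_smul_right,
      inner_apply_right]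

end Adjointable

/-! ### Closed submodules and the orthogonal direct sum -/

/-- A closed submodule of a Hilbert `C⋆`-module. -/
structure HilbertSubmodule extends Submodule ℂ H where
  op_smul_mem' : ∀ (a : A) {x : H}, x ∈ carrier → a • x ∈ carrier
  isClosed' : IsClosed carrier

namespace HilbertSubmodule

variable {A H}

instance : CoeSort (HilbertSubmodule A H) (Type _) := ⟨fun M => M.toSubmodule⟩

variable (M : HilbertSubmodule A H)

instance : SMul A M := ⟨fun a x => ⟨a • (x : H), M.op_smul_mem' a x.2⟩⟩

instance : CStarModule A M where
  inner x y := inner A (x : H) (y : H)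
  inner_add_right := by simp
  inner_self_nonneg := CStarModule.inner_self_nonneg
  inner_self {x} := by
    rw [CStarModule.inner_self]
    exact ZeroMemClass.coe_eq_zero
  inner_op_smul_right := CStarModule.inner_op_smul_right
  inner_smul_right_complex := by simp
  star_inner x y := CStarModule.star_inner _ _
  norm_eq_sqrt_norm_inner_self x := CStarModule.norm_eq_sqrt_norm_inner_self (A := A) (x : H)

theorem inner_coe (x y : M) : inner A x y = inner A (x : H) (y : H) := rfl

instance [CompleteSpace H] : CompleteSpace M := M.isClosed'.completeSpace_coe

end HilbertSubmodule

/-- The orthogonal direct sum `H ⊕ K` of Hilbert `C⋆`-modules, with the inner product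
`⟪(x₁, y₁), (x₂, y₂)⟫ = ⟪x₁, x₂⟫ + ⟪y₁, y₂⟫`. -/
abbrev HilbertSum : Type _ := WithCStarModule A (H × K)

variable {A H K L}

/-- `M` is orthogonally complemented: `H = M + M^⊥`. -/
def IsOrthogonallyComplemented (A : Type*) [NonUnitalCStarAlgebra A] [PartialOrder A]
    [SMul A H] [CStarModule A H] (M : Set H) : Prop :=
  ∀ x : H, ∃ y ∈ M, ∃ z : H, (∀ w ∈ M, inner A z w = 0) ∧ x = y + z

namespace Adjointable

/-- The null space `N(T)`. -/
def nullSpace (T : Adjointable A H K) : HilbertSubmodule A H where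
  carrier := {x | T x = 0}
  zero_mem' := T.map_zero'
  add_mem' {x y} hx hy := by
    rw [Set.mem_ofPred_eq] at hx hy ⊢
    rw [map_add', hx, hy, add_zero]
  smul_mem' c x hx := by
    rw [Set.mem_ofPred_eq] at hx ⊢
    rw [map_smul', hx, smul_zero]
  op_smul_mem' a x hx := by
    simp only [Set.mem_ofPred_eq] at hx ⊢
    refine eq_of_inner (A := A) fun z => ?_
    rw [map_op_smul, hx, CStarModule.inner_op_smul_right, CStarModule.inner_zero_right, mul_zero]
  isClosed' := isClosed_singleton.preimage T.toCLM.continuous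

/-- The range `R(P)` of an idempotent `P`, which is a closed submodule. -/
def idemRange (P : Adjointable A H H) (hP : IsIdempotentElem P) : HilbertSubmodule A H where
  carrier := Set.range P
  zero_mem' := ⟨0, P.map_zero'⟩
  add_mem' := by
    rintro _ _ ⟨x, rfl⟩ ⟨y, rfl⟩
    exact ⟨x + y, P.map_add' x y⟩
  smul_mem' := by
    rintro c _ ⟨x, rfl⟩
    exact ⟨c • x, P.map_smul' c x⟩
  op_smul_mem' := by
    rintro a _ ⟨x, rfl⟩
    exact ⟨a • x, P.map_op_smul a x⟩
  isClosed' := by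
    have h : Set.range P = {x | P.toCLM x = x} := by
      ext x
      refine ⟨?_, fun hx => ⟨x, hx⟩⟩
      rintro ⟨y, rfl⟩
      exact DFunLike.congr_fun hP.eq y
    change IsClosed (Set.range P)
    rw [h]
    exact isClosed_eq P.toCLM.continuous continuous_id

theorem apply_apply_of_idem {P : Adjointable A H H} (hP : IsIdempotentElem P) (x : H) :
    P (P x) = P x := DFunLike.congr_fun hP.eq x

/-! ### Block matrices -/

variable {H₁ H₂ K₁ K₂ : Type*}
  [NormedAddCommGroup H₁] [NormedSpace ℂ H₁] [SMul A H₁] [CStarModule A H₁]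
  [NormedAddCommGroup H₂] [NormedSpace ℂ H₂] [SMul A H₂] [CStarModule A H₂]
  [NormedAddCommGroup K₁] [NormedSpace ℂ K₁] [SMul A K₁] [CStarModule A K₁]
  [NormedAddCommGroup K₂] [NormedSpace ℂ K₂] [SMul A K₂] [CStarModule A K₂]

variable (A H K) in
/-- The identity map from `H ⊕ K` to the product space, which is a homeomorphism. -/
def sumEquiv : HilbertSum A H K ≃L[ℂ] (H × K) where
  __ := WithCStarModule.linearEquiv (A := A) ℂ (E := H × K)
  continuous_toFun := (WithCStarModule.uniformEquiv (A := A) (E := H × K)).continuous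
  continuous_invFun := (WithCStarModule.uniformEquiv (A := A) (E := H × K)).symm.continuous

/-- The bounded operator underlying a `2 × 2` block matrix. -/
def blockCLM (a : Adjointable A H₁ K₁) (b : Adjointable A H₂ K₁)
    (c : Adjointable A H₁ K₂) (d : Adjointable A H₂ K₂) :
    HilbertSum A H₁ H₂ →L[ℂ] HilbertSum A K₁ K₂ :=
  (sumEquiv A K₁ K₂).symm.toContinuousLinearMap ∘L
    (((a.toCLM.coprod b.toCLM).prod (c.toCLM.coprod d.toCLM)) ∘L
      (sumEquiv A H₁ H₂).toContinuousLinearMap)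

/-- The adjointable operator `(x, y) ↦ (a x + b y, c x + d y)` given by the block matrix
`(a b; c d)`. -/
def block (a : Adjointable A H₁ K₁) (b : Adjointable A H₂ K₁)
    (c : Adjointable A H₁ K₂) (d : Adjointable A H₂ K₂) :
    Adjointable A (HilbertSum A H₁ H₂) (HilbertSum A K₁ K₂) :=
  mk (blockCLM a b c d) (blockCLM a.adj c.adj b.adj d.adj) fun x y => by
    change inner A (a x.1 + b x.2) y.1 + inner A (c x.1 + d x.2) y.2 =
      inner A x.1 (a.adj y.1 + c.adj y.2) + inner A x.2 (b.adj y.1 + d.adj y.2)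
    simp only [CStarModule.inner_add_left, CStarModule.inner_add_right, inner_apply_left]
    abel

@[simp] theorem block_apply_fst (a : Adjointable A H₁ K₁) (b : Adjointable A H₂ K₁)
    (c : Adjointable A H₁ K₂) (d : Adjointable A H₂ K₂) (x : HilbertSum A H₁ H₂) :
    (block a b c d x).1 = a x.1 + b x.2 := rfl

@[simp] theorem block_apply_snd (a : Adjointable A H₁ K₁) (b : Adjointable A H₂ K₁)
    (c : Adjointable A H₁ K₂) (d : Adjointable A H₂ K₂) (x : HilbertSum A H₁ H₂) :
    (block a b c d x).2 = c x.1 + d x.2 := rfl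

/-- The unitary `U_P : H → R(P) ⊕ N(P)`, `U_P h = (P h, (I - P) h)`, of a projection `P`; its
adjoint is `(h₁, h₂) ↦ h₁ + h₂`. -/
def decompUnitary (P : Adjointable A H H) (hP : IsStarProjection P) :
    Adjointable A H (HilbertSum A (P.idemRange hP.isIdempotentElem) P.nullSpace) :=
  mk
    ((sumEquiv A (P.idemRange hP.isIdempotentElem) P.nullSpace).symm.toContinuousLinearMap ∘L
      ((P.toCLM.codRestrict (P.idemRange hP.isIdempotentElem).toSubmodule
          fun x => ⟨x, rfl⟩).prod
        ((1 - P).toCLM.codRestrict P.nullSpace.toSubmodule fun x => by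
          change P (x - P x) = 0
          rw [map_sub', apply_apply_of_idem hP.isIdempotentElem, sub_self])))
    (((P.idemRange hP.isIdempotentElem).toSubmodule.subtypeL.coprod
        P.nullSpace.toSubmodule.subtypeL) ∘L
      (sumEquiv A (P.idemRange hP.isIdempotentElem) P.nullSpace).toContinuousLinearMap)
    fun x y => by
      obtain ⟨⟨_, z, rfl⟩, ⟨w, hw⟩⟩ := y
      have hw : P w = 0 := hw
      have hs : P.adj = P := hP.isSelfAdjoint
      have hPP := apply_apply_of_idem hP.isIdempotentElem z
      change inner A (P x) (P z) + inner A (x - P x) w = inner A x (P z + w)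
      rw [CStarModule.inner_sub_left, inner_apply_left, inner_apply_left, hs, hPP, hw,
        CStarModule.inner_add_right, CStarModule.inner_zero_right, sub_zero]

@[simp] theorem coe_decompUnitary_fst (P : Adjointable A H H) (hP : IsStarProjection P) (x : H) :
    ((P.decompUnitary hP x).1 : H) = P x := rfl

@[simp] theorem coe_decompUnitary_snd (P : Adjointable A H H) (hP : IsStarProjection P) (x : H) :
    ((P.decompUnitary hP x).2 : H) = x - P x := rfl

theorem decompUnitary_adj_apply (P : Adjointable A H H) (hP : IsStarProjection P)
    (y : HilbertSum A (P.idemRange hP.isIdempotentElem) P.nullSpace) :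
    (P.decompUnitary hP).adj y = (y.1 : H) + (y.2 : H) := by
  apply eq_of_inner (A := A)
  intro z
  rw [← inner_apply_left, WithCStarModule.prod_inner, HilbertSubmodule.inner_coe,
    HilbertSubmodule.inner_coe, coe_decompUnitary_fst, coe_decompUnitary_snd]
  obtain ⟨⟨_, w, rfl⟩, ⟨v, hv⟩⟩ := y
  have hv : P v = 0 := hv
  have hs : P.adj = P := hP.isSelfAdjoint
  have hPP := apply_apply_of_idem hP.isIdempotentElem w
  simp [inner_apply_left, hs, hPP, hv]

/-! ### Quasi-projection pairs -/

/-- `(P, Q)` is a quasi-projection pair. -/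
structure IsQuasiProjectionPair (P Q : Adjointable A H H) : Prop where
  isStarProjection : IsStarProjection P
  isIdempotentElem : IsIdempotentElem Q
  corner₁₁ : P * star Q * P = P * Q * P
  corner₁₂ : P * star Q * (1 - P) = -(P * Q * (1 - P))
  corner₂₂ : (1 - P) * star Q * (1 - P) = (1 - P) * Q * (1 - P)

/-- A quasi-projection pair is harmonious if the closures of the ranges of `P Q (I - P)` and
`(I - P) Q P` are orthogonally complemented. -/
structure IsHarmonious (P Q : Adjointable A H H) : Prop extends IsQuasiProjectionPair P Q where
  complemented₅ : IsOrthogonallyComplemented A (closure (Set.range ⇑(P * Q * (1 - P))))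
  complemented₆ : IsOrthogonallyComplemented A (closure (Set.range ⇑((1 - P) * Q * P)))

/-! ### The matched projection -/

/-- `X` is a Moore-Penrose inverse of `T`. -/
structure IsMoorePenroseInverse (T : Adjointable A H K) (X : Adjointable A K H) : Prop where
  mul_mul_left : (T.comp X).comp T = T
  mul_mul_right : (X.comp T).comp X = X
  adj_left : (T.comp X).adj = T.comp X
  adj_right : (X.comp T).adj = X.comp T

open scoped Classical in
/-- The Moore-Penrose inverse `T†`, which is unique when it exists (and `0` otherwise). -/
def moorePenrose (T : Adjointable A H K) : Adjointable A K H :=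
  if h : ∃ X, IsMoorePenroseInverse T X then h.choose else 0

variable [CompleteSpace H]

/-- The matched projection
`m(Q) = ½ (|Q⋆| + Q⋆) |Q⋆|† (|Q⋆| + I)⁻¹ (|Q⋆| + Q)`, where `|T| = (T⋆ T)^{1/2}`. -/
def matchedProjection (Q : Adjointable A H H) : Adjointable A H H :=
  (1 / 2 : ℂ) • ((CFC.abs (star Q) + star Q) * moorePenrose (CFC.abs (star Q)) *
    Ring.inverse (CFC.abs (star Q) + 1) * (CFC.abs (star Q) + Q))

/-! ### The canonical block matrix representation -/

/-- `ℓ(T) = (T² - T)^{1/2}`. -/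
def ell (T : Adjointable A H H) : Adjointable A H H := CFC.sqrt (T ^ 2 - T)

/-- The function `f`, equal to `1` on `[1, ∞)` and to `-1` on `(-∞, 0]`.  Only its values on
`(-∞, 0] ∪ [1, ∞)` matter. -/
def signFun (t : ℝ) : ℝ := if 1 ≤ t then 1 else -1

/-- The operator `f(T)`, by the continuous functional calculus in the `C⋆`-algebra `L(H)`. -/
def signOp (T : Adjointable A H H) : Adjointable A H H := cfc signFun T

/-- The operators `T`, `U`, `Q₀` constitute the canonical `2 × 2` block matrix representation of
`Q` induced by the projection `P`:
`U_P Q U_P⋆ = (T, -ℓ(T) U⋆; U ℓ(T), U (I - T) U⋆ + Q₀)`. -/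
structure IsCanonicalRep (P : Adjointable A H H) (hP : IsStarProjection P)
    (Q : Adjointable A H H)
    (T : Adjointable A (P.idemRange hP.isIdempotentElem) (P.idemRange hP.isIdempotentElem))
    (U : Adjointable A (P.idemRange hP.isIdempotentElem) P.nullSpace)
    (Q₀ : Adjointable A P.nullSpace P.nullSpace) : Prop where
  isSelfAdjoint : IsSelfAdjoint T
  nonneg : 0 ≤ T ^ 2 - T
  partialIsometry : (U.comp U.adj).comp U = U
  isStarProjection : IsStarProjection Q₀
  range_adj : Set.range U.adj = closure (Set.range ⇑(T ^ 2 - T))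
  adj_comp_eq_zero : U.adj.comp Q₀ = 0
  block_eq : ((P.decompUnitary hP).comp Q).comp (P.decompUnitary hP).adj =
    block T (-(T.ell.comp U.adj)) (U.comp T.ell) ((U.comp (1 - T)).comp U.adj + Q₀)

end Adjointable

end Adjointable

end

namespace Adjointable

/-! ### Calculus of block operators built from `U` and `Q₀`. -/

section Blocks

variable {A : Type*} [NonUnitalCStarAlgebra A] [PartialOrder A] [StarOrderedRing A]
variable {H : Type*} [NormedAddCommGroup H] [NormedSpace ℂ H] [SMul A H] [CStarModule A H]
variable {H₁ : Type*} [NormedAddCommGroup H₁] [NormedSpace ℂ H₁] [SMul A H₁] [CStarModule A H₁]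
variable {H₂ : Type*} [NormedAddCommGroup H₂] [NormedSpace ℂ H₂] [SMul A H₂] [CStarModule A H₂]

/-! Operators with blocks `(a, b U⋆; U c, U d U⋆ + λ Q₀)`, with `a, b, c, d` continuous functions of
`T`, multiply like a 2 × 2 matrix of functions together with a separate scalar `λ`, provided `b` is
supported on the initial projection `U⋆ U` and `d` commutes with it (`blockPullback_mul`). Both
conditions hold here: `U⋆ U` projects onto the closed range of `T² - T`, hence commutes with `T` and
fixes `ℓ(T)`. So the theorem reduces to an identity of matrices over the commutative ring of
functions on the spectrum of `T`.

Write `i` for the coordinate, `l² = i² - i`, and `F = ±1` for the function `f`. Then `Q` is `(i, -l;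
l, 1 - i)` with scalar 1. The matrix `M = (i, l; l, i - 1)` has trace `2i - 1` and determinant 0, so
`M² = (2i - 1) M`, while `Q Q⋆ = (2i - 1) M` on the matrix part. As `2i - 1` vanishes nowhere on the
spectrum and has sign `F`, the matrix part of `|Q⋆|` is `F M = |2i - 1| E`, where `E = M / (2i - 1)`
is a projection. The Moore-Penrose inverse and `(|Q⋆| + I)⁻¹` are then explicit, and the formula for
`m(Q)` is checked pointwise for `F = 1` and `F = -1` (`matchedProjection_blockPullback_of_hom`). The
functional calculus of `T` supplies the functions (`matchedProjection_blockPullback`). -/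

theorem adj_block (a : Adjointable A H₁ H₁) (b : Adjointable A H₂ H₁)
    (c : Adjointable A H₁ H₂) (d : Adjointable A H₂ H₂) :
    (block a b c d).adj = block a.adj c.adj b.adj d.adj :=
  eq_adj fun x y => by
    change inner A (a x.1 + b x.2) y.1 + inner A (c x.1 + d x.2) y.2 =
      inner A x.1 (a.adj y.1 + c.adj y.2) + inner A x.2 (b.adj y.1 + d.adj y.2)
    simp only [CStarModule.inner_add_left, CStarModule.inner_add_right, inner_apply_left]
    abel

/-- The operator on `H` whose block matrix with respect to `V : H → H₁ ⊕ H₂` is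
`(a, b U⋆; U c, U d U⋆ + l Q₀)`. -/
noncomputable def blockPullback (V : Adjointable A H (HilbertSum A H₁ H₂))
    (U : Adjointable A H₁ H₂) (Q₀ : Adjointable A H₂ H₂) (a b c d : Adjointable A H₁ H₁) (l : ℂ) :
    Adjointable A H H :=
  V.adj.comp ((block a (b.comp U.adj) (U.comp c) ((U.comp d).comp U.adj + l • Q₀)).comp V)

variable {V : Adjointable A H (HilbertSum A H₁ H₂)} {U : Adjointable A H₁ H₂}
  {Q₀ : Adjointable A H₂ H₂}

theorem blockPullback_apply (a b c d : Adjointable A H₁ H₁) (l : ℂ) (x : H) :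
    blockPullback V U Q₀ a b c d l x =
      V.adj (block a (b.comp U.adj) (U.comp c) ((U.comp d).comp U.adj + l • Q₀) (V x)) := rfl

theorem blockPullback_add (a b c d a' b' c' d' : Adjointable A H₁ H₁) (l l' : ℂ) :
    blockPullback V U Q₀ a b c d l + blockPullback V U Q₀ a' b' c' d' l' =
      blockPullback V U Q₀ (a + a') (b + b') (c + c') (d + d') (l + l') := by
  ext x
  rw [add_apply, blockPullback_apply, blockPullback_apply, blockPullback_apply, ← map_add']
  congr 1
  refine Prod.ext ?_ ?_
  · change (a _ + b _) + (a' _ + b' _) = (a + a') _ + (b + b') _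
    simp only [add_apply]
    abel
  · change (U (c _) + (U (d _) + l • Q₀ _)) + (U (c' _) + (U (d' _) + l' • Q₀ _)) =
      U ((c + c') _) + (U ((d + d') _) + (l + l') • Q₀ _)
    simp only [add_apply, map_add', add_smul]
    abel

theorem star_blockPullback (hQ₀ : IsStarProjection Q₀) (a b c d : Adjointable A H₁ H₁) (l : ℂ) :
    star (blockPullback V U Q₀ a b c d l) =
      blockPullback V U Q₀ (star a) (star c) (star b) (star d) (star l) := by
  have h : Q₀.adj = Q₀ := hQ₀.isSelfAdjoint
  simp only [blockPullback, star_def, adj_comp, adj_block, adj_adj, adj_add, adj_smul, h]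
  rfl

/-- Every inner factor `U⋆ U` in the product is absorbed: into `b` by `hb`, and, after being moved
past `d`, into the `U` on the left. The cross terms with `Q₀` vanish because `U⋆ Q₀ = 0` and, taking
adjoints, `Q₀ U = 0`. -/
theorem blockPullback_mul (hV : ∀ x, V (V.adj x) = x) (hU : (U.comp U.adj).comp U = U)
    (hQ₀ : IsStarProjection Q₀) (hUQ : U.adj.comp Q₀ = 0)
    {a b c d a' b' c' d' : Adjointable A H₁ H₁} (hb : b * U.adj.comp U = b)
    (hd : Commute (U.adj.comp U) d) (l l' : ℂ) :
    blockPullback V U Q₀ a b c d l * blockPullback V U Q₀ a' b' c' d' l' =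
      blockPullback V U Q₀ (a * a' + b * c') (a * b' + b * d') (c * a' + d * c')
        (c * b' + d * d') (l * l') := by
  have hU' : ∀ x, U (U.adj (U x)) = U x := DFunLike.congr_fun hU
  have hb' : ∀ x, b (U.adj (U x)) = b x := DFunLike.congr_fun hb
  have hd' : ∀ x, U (d (U.adj (U x))) = U (d x) := fun x => by
    have h : U.adj (U (d x)) = d (U.adj (U x)) := DFunLike.congr_fun hd.eq x
    rw [← h, hU']
  have hUQ' : ∀ x, U.adj (Q₀ x) = 0 := DFunLike.congr_fun hUQ
  have hs : Q₀.adj = Q₀ := hQ₀.isSelfAdjoint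
  have hQU : ∀ x, Q₀ (U x) = 0 := fun x => by
    have h := congrArg adj hUQ
    rw [adj_comp, adj_adj, hs] at h
    have h0 : (0 : Adjointable A H₂ H₁).adj = 0 := eq_adj fun x y => by simp
    rw [h0] at h
    exact DFunLike.congr_fun h x
  have hQQ : ∀ x, Q₀ (Q₀ x) = Q₀ x := apply_apply_of_idem hQ₀.isIdempotentElem
  ext x
  rw [mul_apply, blockPullback_apply, blockPullback_apply, blockPullback_apply, hV]
  congr 1
  refine Prod.ext ?_ ?_
  · change a (a' _ + b' _) + b (U.adj (U (c' _) + (U (d' _) + l' • Q₀ _))) =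
      (a * a' + b * c') _ + (a * b' + b * d') _
    simp only [add_apply, mul_apply, map_add', map_smul', hUQ', hb', smul_zero, add_zero]
    abel
  · change U (c (a' _ + b' _)) + (U (d (U.adj (U (c' _) + (U (d' _) + l' • Q₀ _)))) +
        l • Q₀ (U (c' _) + (U (d' _) + l' • Q₀ _))) =
      U ((c * a' + d * c') _) + (U ((c * b' + d * d') _) + (l * l') • Q₀ _)
    simp only [add_apply, mul_apply, map_add', map_smul', hUQ', hd', hQU, hQQ, smul_zero, add_zero,
      zero_add, mul_smul]
    abel

/-! ### Moore-Penrose inverses and the matched projection -/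

theorem IsMoorePenroseInverse.unique {K : Type*} [NormedAddCommGroup K] [NormedSpace ℂ K]
    [SMul A K] [CStarModule A K] {T : Adjointable A H K} {X Y : Adjointable A K H}
    (hX : IsMoorePenroseInverse T X) (hY : IsMoorePenroseInverse T Y) : X = Y := by
  have h₁ : T.comp X = T.comp Y := by
    calc T.comp X = ((T.comp Y).comp T).comp X := by rw [hY.mul_mul_left]
      _ = (T.comp Y).adj.comp (T.comp X).adj := by rw [hX.adj_left, hY.adj_left]; rfl
      _ = (((T.comp X).comp T).comp Y).adj := by rw [← adj_comp]; rfl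
      _ = T.comp Y := by rw [hX.mul_mul_left, hY.adj_left]
  have h₂ : X.comp T = Y.comp T := by
    calc X.comp T = X.comp ((T.comp Y).comp T) := by rw [hY.mul_mul_left]
      _ = (X.comp T).adj.comp (Y.comp T).adj := by rw [hX.adj_right, hY.adj_right]; rfl
      _ = (Y.comp ((T.comp X).comp T)).adj := by rw [← adj_comp]; rfl
      _ = Y.comp T := by rw [hX.mul_mul_left, hY.adj_right]
  calc X = X.comp (T.comp X) := hX.mul_mul_right.symm
    _ = (X.comp T).comp Y := by rw [h₁]; rfl
    _ = Y := by rw [h₂, hY.mul_mul_right]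

theorem IsMoorePenroseInverse.moorePenrose_eq {T : Adjointable A H H} {X : Adjointable A H H}
    (hX : IsMoorePenroseInverse T X) : moorePenrose T = X := by
  have h : ∃ X, IsMoorePenroseInverse T X := ⟨X, hX⟩
  rw [moorePenrose, dif_pos h]
  exact h.choose_spec.unique hX

theorem isUnit_add_one_of_nonneg [CompleteSpace H] {R : Adjointable A H H} (hR : 0 ≤ R) :
    IsUnit (R + 1) := by
  have h : (-1 : ℝ) ∉ spectrum ℝ R := fun h => by
    have := spectrum_nonneg_of_nonneg hR h
    norm_num at this
  rw [spectrum.notMem_iff] at h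
  have := h.neg
  simpa [add_comm] using this

/-- Uniqueness of positive square roots identifies `R` with `|Q⋆|`. Giving `W` through `W (R + 1) =
X` means that the inverse of `R + 1` never has to be computed. -/
theorem matchedProjection_eq [CompleteSpace H] {Q R X W : Adjointable A H H} (hR : 0 ≤ R)
    (hRQ : R * R = Q * star Q) (hX : IsMoorePenroseInverse R X) (hW : W * (R + 1) = X) :
    matchedProjection Q = (1 / 2 : ℂ) • ((R + star Q) * W * (R + Q)) := by
  have habs : CFC.abs (star Q) = R := by
    rw [CFC.abs, star_star]
    exact CFC.sqrt_unique hRQ hR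
  have hinv : X * Ring.inverse (R + 1) = W := by
    rw [← hW, mul_assoc, Ring.mul_inverse_cancel _ (isUnit_add_one_of_nonneg hR), mul_one]
  rw [matchedProjection, habs, hX.moorePenrose_eq, mul_assoc (R + star Q), hinv]

/-! ### The initial projection of `U` -/

/-- The range of `p = U⋆ U` is the closure of the range of `T² - T`, which `T` preserves, so `p T p
= T p`. Taking adjoints gives `p T p = p T`. -/
theorem commute_initial_projection (hU : (U.comp U.adj).comp U = U)
    {T : Adjointable A H₁ H₁} (hT : IsSelfAdjoint T)
    (hr : Set.range U.adj = closure (Set.range ⇑(T ^ 2 - T))) : Commute (U.adj.comp U) T := by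
  have hU' : ∀ y, U.adj (U (U.adj y)) = U.adj y := by
    have h := congrArg adj hU
    simp only [adj_comp, adj_adj] at h
    exact DFunLike.congr_fun h
  have hmaps : ∀ x ∈ closure (Set.range ⇑(T ^ 2 - T)), T x ∈ closure (Set.range ⇑(T ^ 2 - T)) := by
    intro x hx
    refine map_mem_closure T.toCLM.continuous hx ?_
    rintro _ ⟨y, rfl⟩
    refine ⟨T y, ?_⟩
    have h : (T ^ 2 - T) * T = T * (T ^ 2 - T) := by noncomm_ring
    exact DFunLike.congr_fun h y
  have h₁ : U.adj.comp U * T * U.adj.comp U = T * U.adj.comp U := by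
    ext x
    have hx : T (U.adj (U x)) ∈ Set.range U.adj := hr ▸ hmaps _ (hr ▸ ⟨U x, rfl⟩)
    obtain ⟨y, hy⟩ := hx
    change U.adj (U (T (U.adj (U x)))) = T (U.adj (U x))
    rw [← hy, hU']
  have hp : star (U.adj.comp U) = U.adj.comp U := by
    rw [star_def, adj_comp, adj_adj]
  have h₂ := congrArg star h₁
  simp only [star_mul, hp, hT.star_eq, ← mul_assoc] at h₂
  exact h₂.symm.trans h₁

/-- The range condition only shows that `p = U⋆ U` fixes `L²`. The `C⋆`-identity passes from `L²` to
`L`: `(L - p L)(L - p L)⋆ = L² - L² p - p L² + p L² p = 0`. -/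
theorem mul_initial_projection (hU : (U.comp U.adj).comp U = U)
    {T L : Adjointable A H₁ H₁} (hL : IsSelfAdjoint L) (hLT : L * L = T ^ 2 - T)
    (hr : Set.range U.adj = closure (Set.range ⇑(T ^ 2 - T))) : L * U.adj.comp U = L := by
  have hU' : ∀ y, U.adj (U (U.adj y)) = U.adj y := by
    have h := congrArg adj hU
    simp only [adj_comp, adj_adj] at h
    exact DFunLike.congr_fun h
  have hp : star (U.adj.comp U) = U.adj.comp U := by
    rw [star_def, adj_comp, adj_adj]
  have h : U.adj.comp U * (L * L) = L * L := by
    rw [hLT]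
    ext x
    obtain ⟨y, hy⟩ : (T ^ 2 - T) x ∈ Set.range U.adj := hr ▸ subset_closure ⟨x, rfl⟩
    change U.adj (U ((T ^ 2 - T) x)) = (T ^ 2 - T) x
    rw [← hy, hU']
  have h0 : (L - U.adj.comp U * L) * star (L - U.adj.comp U * L) = 0 := by
    simp only [star_sub, star_mul, hp, hL.star_eq, sub_mul, mul_sub]
    have e : L * (L * U.adj.comp U) = L * L := by
      have := congrArg star h
      simpa only [star_mul, hp, hL.star_eq, mul_assoc] using this
    rw [mul_assoc, h, mul_assoc, e, h]
    simp
  have h1 := CStarRing.mul_star_self_eq_zero_iff _ |>.mp h0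
  have h2 := congrArg star (sub_eq_zero.mp h1)
  simpa only [star_mul, hp, hL.star_eq] using h2.symm

end Blocks

end Adjointable

namespace Adjointable

/-! ### The matched projection as a matrix computation over functions on the spectrum. -/

section Main

variable {A : Type*} [NonUnitalCStarAlgebra A] [PartialOrder A] [StarOrderedRing A]
variable {H : Type*} [NormedAddCommGroup H] [NormedSpace ℂ H] [SMul A H] [CStarModule A H]
variable {H₁ : Type*} [NormedAddCommGroup H₁] [NormedSpace ℂ H₁] [SMul A H₁] [CStarModule A H₁]
variable {H₂ : Type*} [NormedAddCommGroup H₂] [NormedSpace ℂ H₂] [SMul A H₂] [CStarModule A H₂]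

theorem blockPullback_one {V : Adjointable A H (HilbertSum A H₁ H₂)} {U : Adjointable A H₁ H₂}
    {Q₀ : Adjointable A H₂ H₂} (a b c d : Adjointable A H₁ H₁) :
    blockPullback V U Q₀ a b c d 1 = V.adj.comp
      ((block a (b.comp U.adj) (U.comp c) ((U.comp d).comp U.adj + Q₀)).comp V) := by
  rw [blockPullback, one_smul]

theorem le_zero_or_one_le_of_mem_spectrum [CompleteSpace H₁] {T : Adjointable A H₁ H₁}
    (hT : IsSelfAdjoint T) (h0 : 0 ≤ T ^ 2 - T) {t : ℝ} (ht : t ∈ spectrum ℝ T) :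
    t ≤ 0 ∨ 1 ≤ t := by
  have h : cfc (fun x : ℝ => x ^ 2 - x) T = T ^ 2 - T := by
    rw [cfc_sub (fun x : ℝ => x ^ 2) (fun x => x) T, cfc_pow_id (R := ℝ) T 2, cfc_id' ℝ T]
  rw [← h, cfc_nonneg_iff (fun x : ℝ => x ^ 2 - x) T] at h0
  have := h0 t ht
  by_contra! hc
  nlinarith

/-- The hypotheses encode `g = (2i - 1)⁻¹`, `s = |2i - 1|^(-1/2)` up to sign, and `k = g² (|2i - 1|
+ 1)⁻¹` as ring identities, with `F (2i - 1)` in the role of `|2i - 1|`. All matrix identities then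
follow by polynomial algebra. -/
theorem matchedProjection_blockPullback_of_hom [CompleteSpace H]
    {V : Adjointable A H (HilbertSum A H₁ H₂)} {U : Adjointable A H₁ H₂}
    {Q₀ : Adjointable A H₂ H₂} (hV : ∀ x, V (V.adj x) = x)
    (hU : (U.comp U.adj).comp U = U) (hQ₀ : IsStarProjection Q₀) (hUQ : U.adj.comp Q₀ = 0)
    {X : Type*} [TopologicalSpace X] (φ : C(X, ℝ) →⋆ₐ[ℝ] Adjointable A H₁ H₁)
    (hφ : ∀ x, Commute (U.adj.comp U) (φ x)) {i F l g s k : C(X, ℝ)}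
    (hlU : φ l * U.adj.comp U = φ l) (hF : ∀ t, F t = 1 ∨ F t = -1) (hl : l * l = i * i - i)
    (hg : g * (2 * i - 1) = 1) (hs : s * s * F * (2 * i - 1) = 1)
    (hk : k * (F * (2 * i - 1) + 1) = g * g) :
    matchedProjection (blockPullback V U Q₀ (φ i) (φ (-l)) (φ l) (φ (1 - i)) 1) =
      (1 / 2 : ℂ) • blockPullback V U Q₀ (φ (1 + F)) (φ 0) (φ 0) (φ (1 - F)) 2 := by
  let B (a b c d : C(X, ℝ)) (z : ℂ) := blockPullback V U Q₀ (φ a) (φ b) (φ c) (φ d) z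
  have hF2 : F * F = 1 := by
    ext t
    rcases hF t with h | h <;> simp [h]
  have Badd (a b c d a' b' c' d' : C(X, ℝ)) (z z' : ℂ) : B a b c d z + B a' b' c' d' z' =
      B (a + a') (b + b') (c + c') (d + d') (z + z') := by
    simp only [B, blockPullback_add, map_add]
  -- The upper right entry of the left factor is kept as a multiple of `l`, which guarantees that it
  -- is supported on `U⋆ U`.
  have Bmul (a b c d a' b' c' d' : C(X, ℝ)) (z z' : ℂ) : B a (b * l) c d z * B a' b' c' d' z' =
      B (a * a' + b * l * c') (a * b' + b * l * d') (c * a' + d * c') (c * b' + d * d')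
        (z * z') := by
    have hb : φ (b * l) * U.adj.comp U = φ (b * l) := by rw [map_mul, mul_assoc, hlU]
    simp only [B]
    rw [blockPullback_mul hV hU hQ₀ hUQ hb (hφ d)]
    simp only [map_add, map_mul]
  have Bstar (a b c d : C(X, ℝ)) (z : ℂ) : star (B a b c d z) = B a c b d (star z) := by
    simp only [B, star_blockPullback hQ₀, ← map_star, star_trivial]
  have Bcongr {a b c d a' b' c' d' : C(X, ℝ)} {z z' : ℂ} (ha : a = a') (hb : b = b') (hc : c = c')
      (hd : d = d') (hz : z = z') : B a b c d z = B a' b' c' d' z' := by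
    rw [ha, hb, hc, hd, hz]
  have hQ : blockPullback V U Q₀ (φ i) (φ (-l)) (φ l) (φ (1 - i)) 1 = B i (-1 * l) l (1 - i) 1 := by
    rw [neg_one_mul]
  -- With `M = (i, l; l, i - 1)`, the matrix parts are: `R = F M` is `|Q⋆|`, `Y = s F M` satisfies
  -- `Y⋆ Y = R` and so witnesses positivity, `N = g² F M` is the Moore-Penrose inverse of `R`, `E =
  -- g M` is the projection `R N = N R`, and `W = k F M` is `N (R + 1)⁻¹`. The scalar 1/2 in `W` is
  -- `(1 + 1)⁻¹`.
  set R := B (F * i) (F * l) (F * l) (F * (i - 1)) 1 with hR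
  set Y := B (s * F * i) (s * F * l) (s * F * l) (s * F * (i - 1)) 1 with hY
  set N := B (g * g * F * i) (g * g * F * l) (g * g * F * l) (g * g * F * (i - 1)) 1 with hN
  set E := B (g * i) (g * l) (g * l) (g * (i - 1)) 1 with hE
  set W := B (k * F * i) (k * F * l) (k * F * l) (k * F * (i - 1)) (1 / 2) with hW
  have hE' : star E = E := by rw [hE, Bstar, star_one]
  have hRY : star Y * Y = R := by
    rw [hY, Bstar, star_one, Bmul]
    apply Bcongr
    · linear_combination F * i * hs + s ^ 2 * F ^ 2 * hl
    · linear_combination F * l * hs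
    · linear_combination F * l * hs
    · linear_combination F * (i - 1) * hs + s ^ 2 * F ^ 2 * hl
    · ring
  have hRN : R * N = E := by
    rw [hR, hN, Bmul]
    apply Bcongr
    · linear_combination g ^ 2 * (i ^ 2 + l ^ 2) * hF2 + g ^ 2 * hl + g * i * hg
    · linear_combination g ^ 2 * l * (2 * i - 1) * hF2 + g * l * hg
    · linear_combination g ^ 2 * l * (2 * i - 1) * hF2 + g * l * hg
    · linear_combination g ^ 2 * (l ^ 2 + (i - 1) ^ 2) * hF2 + g ^ 2 * hl + g * (i - 1) * hg
    · ring
  have hNR : N * R = E := by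
    rw [hR, hN, Bmul]
    apply Bcongr
    · linear_combination g ^ 2 * (i ^ 2 + l ^ 2) * hF2 + g ^ 2 * hl + g * i * hg
    · linear_combination g ^ 2 * l * (2 * i - 1) * hF2 + g * l * hg
    · linear_combination g ^ 2 * l * (2 * i - 1) * hF2 + g * l * hg
    · linear_combination g ^ 2 * (l ^ 2 + (i - 1) ^ 2) * hF2 + g ^ 2 * hl + g * (i - 1) * hg
    · ring
  have hER : E * R = R := by
    rw [hE, hR, Bmul]
    apply Bcongr
    · linear_combination g * F * hl + F * i * hg
    · linear_combination F * l * hg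
    · linear_combination F * l * hg
    · linear_combination g * F * hl + F * (i - 1) * hg
    · ring
  have hEN : E * N = N := by
    rw [hE, hN, Bmul]
    apply Bcongr
    · linear_combination g ^ 3 * F * hl + g ^ 2 * F * i * hg
    · linear_combination g ^ 2 * F * l * hg
    · linear_combination g ^ 2 * F * l * hg
    · linear_combination g ^ 3 * F * hl + g ^ 2 * F * (i - 1) * hg
    · ring
  have hWR : W * (R + 1) = N := by
    rw [mul_add, mul_one, hW, hR, Bmul, Badd]
    apply Bcongr
    · linear_combination k * F ^ 2 * hl + F * i * hk
    · linear_combination F * l * hk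
    · linear_combination F * l * hk
    · linear_combination k * F ^ 2 * hl + F * (i - 1) * hk
    · norm_num
  have hRQ : R * R = B i (-1 * l) l (1 - i) 1 * star (B i (-1 * l) l (1 - i) 1) := by
    rw [Bstar, star_one, hR, Bmul, Bmul]
    apply Bcongr
    · linear_combination (i ^ 2 + l ^ 2) * hF2
    · linear_combination l * (2 * i - 1) * hF2
    · linear_combination l * (2 * i - 1) * hF2
    · linear_combination (l ^ 2 + (i - 1) ^ 2) * hF2
    · ring
  have hMP : IsMoorePenroseInverse R N :=
    { mul_mul_left := by change R * N * R = R; rw [hRN, hER]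
      mul_mul_right := by change N * R * N = N; rw [hNR, hEN]
      adj_left := by change star (R * N) = R * N; rw [hRN, hE']
      adj_right := by change star (N * R) = N * R; rw [hNR, hE'] }
  have hk2 : k * (F * (2 * i - 1) + 1) * (2 * i - 1) ^ 2 = 1 := by
    linear_combination (2 * i - 1) ^ 2 * hk + (g * (2 * i - 1) + 1) * hg
  rw [hQ, matchedProjection_eq (hRY ▸ star_mul_self_nonneg Y) hRQ hMP hWR, Bstar, star_one,
    hR, hW, Badd, Badd]
  -- Both left factors need their upper right entry rewritten as a multiple of `l` before `Bmul`
  -- applies.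
  rw [show F * l + l = (F + 1) * l by ring, Bmul,
    show (F * i + i) * (k * F * l) + (F + 1) * l * (k * F * (i - 1)) =
      ((F * i + i) * (k * F) + (F + 1) * (k * F * (i - 1))) * l by ring, Bmul]
  have htwo (t : X) : (2 : C(X, ℝ)) t = 2 := rfl
  congr 1
  apply Bcongr
  -- Where `F = -1` this corner vanishes. Where `F = 1` it equals `4 k i (2i - 1)²`, which is 2 by
  -- `hk2`. The lower right corner is symmetric, with `1 - i` in place of `i`.
  · ext t
    have h1 := DFunLike.congr_fun hl t
    have h2 := DFunLike.congr_fun hk2 t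
    simp [htwo] at h1 h2 ⊢
    rcases hF t with h | h <;> rw [h] at h2 ⊢
    · linear_combination 4 * k t * (3 * i t - 1) * h1 + 2 * h2
    · ring
  · ext t
    simp
    rcases hF t with h | h <;> rw [h] <;> ring
  · ext t
    simp
    rcases hF t with h | h <;> rw [h] <;> ring
  · ext t
    have h1 := DFunLike.congr_fun hl t
    have h2 := DFunLike.congr_fun hk2 t
    simp [htwo] at h1 h2 ⊢
    rcases hF t with h | h <;> rw [h] at h2 ⊢
    · ring
    · linear_combination -4 * k t * (3 * i t - 2) * h1 + 2 * h2
  · norm_num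

/-- The functions required by the matrix computation exist because the spectrum of `T` avoids the
open interval from 0 to 1, and in particular the zero of `2t - 1`. -/
theorem matchedProjection_blockPullback [CompleteSpace H] [CompleteSpace H₁]
    {V : Adjointable A H (HilbertSum A H₁ H₂)} {U : Adjointable A H₁ H₂}
    {Q₀ : Adjointable A H₂ H₂} (hV : ∀ x, V (V.adj x) = x)
    (hU : (U.comp U.adj).comp U = U) (hQ₀ : IsStarProjection Q₀) (hUQ : U.adj.comp Q₀ = 0)
    {T : Adjointable A H₁ H₁} (hT : IsSelfAdjoint T) (h0 : 0 ≤ T ^ 2 - T)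
    (hr : Set.range U.adj = closure (Set.range ⇑(T ^ 2 - T))) :
    matchedProjection (blockPullback V U Q₀ T (-T.ell) T.ell (1 - T) 1) =
      (1 / 2 : ℂ) • blockPullback V U Q₀ (1 + T.signOp) 0 0 (1 - T.signOp) 2 := by
  have hσ : ∀ t : spectrum ℝ T, (t : ℝ) ≤ 0 ∨ 1 ≤ (t : ℝ) :=
    fun t => le_zero_or_one_le_of_mem_spectrum hT h0 t.2
  have hne : ∀ t : spectrum ℝ T, 2 * (t : ℝ) - 1 ≠ 0 := fun t => by
    rcases hσ t with h | h <;> intro h' <;> linarith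
  have hsign : ContinuousOn signFun (spectrum ℝ T) := by
    -- On the spectrum, `signFun` is the sign of `2t - 1`, hence continuous there despite its jump
    -- at 1.
    have h : ContinuousOn (fun t : ℝ => (2 * t - 1) / |2 * t - 1|) (spectrum ℝ T) :=
      ContinuousOn.div (by fun_prop) (by fun_prop) fun t ht => abs_ne_zero.mpr (hne ⟨t, ht⟩)
    refine h.congr fun t ht => ?_
    rcases hσ ⟨t, ht⟩ with h | h
    · have h : t ≤ 0 := h
      have h' : 2 * t - 1 < 0 := by linarith
      rw [signFun, if_neg (by linarith)]
      simp only
      rw [abs_of_neg h', div_neg, div_self h'.ne]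
    · have h : 1 ≤ t := h
      have h' : 0 < 2 * t - 1 := by linarith
      rw [signFun, if_pos h]
      simp only
      rw [abs_of_pos h', div_self h'.ne']
  let φ := cfcHom (R := ℝ) hT
  let i : C(spectrum ℝ T, ℝ) := .restrict (spectrum ℝ T) (.id ℝ)
  let F : C(spectrum ℝ T, ℝ) := ⟨_, hsign.domRestrict⟩
  let l : C(spectrum ℝ T, ℝ) := ⟨fun t => √((t : ℝ) ^ 2 - t), by fun_prop⟩
  -- A square root of `l`: it makes `φ l` positive, so that `φ l` is the positive square root
  -- `T.ell`.
  let r : C(spectrum ℝ T, ℝ) := ⟨fun t => √√((t : ℝ) ^ 2 - t), by fun_prop⟩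
  let g : C(spectrum ℝ T, ℝ) := ⟨fun t => (2 * (t : ℝ) - 1)⁻¹,
    Continuous.inv₀ (by fun_prop) hne⟩
  let s : C(spectrum ℝ T, ℝ) := ⟨fun t => √(|2 * (t : ℝ) - 1|⁻¹),
    (Continuous.inv₀ (by fun_prop) fun t => abs_ne_zero.mpr (hne t)).sqrt⟩
  let k : C(spectrum ℝ T, ℝ) := ⟨fun t => ((2 * (t : ℝ) - 1) ^ 2 * (|2 * (t : ℝ) - 1| + 1))⁻¹,
    Continuous.inv₀ (by fun_prop) fun t =>
      mul_ne_zero (pow_ne_zero 2 (hne t)) (by positivity)⟩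
  have hi : φ i = T := cfcHom_id hT
  have hFφ : φ F = T.signOp := (cfc_apply signFun T hT hsign).symm
  have hl : l * l = i * i - i := by
    ext t
    change √((t : ℝ) ^ 2 - t) * √((t : ℝ) ^ 2 - t) = t * t - t
    rw [Real.mul_self_sqrt, sq]
    rcases hσ t with h | h <;> nlinarith
  have hrr : star r * r = l := by
    ext t
    exact Real.mul_self_sqrt (Real.sqrt_nonneg _)
  have hll : φ l * φ l = T ^ 2 - T := by
    rw [← map_mul, hl, map_sub, map_mul, hi, sq]
  have hlφ : φ l = T.ell := by
    refine (CFC.sqrt_unique hll ?_).symm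
    rw [← hrr, map_mul, map_star]
    exact star_mul_self_nonneg _
  have hlsa : IsSelfAdjoint (φ l) := by
    rw [IsSelfAdjoint, ← map_star, star_trivial]
  have hφ : ∀ x, Commute (U.adj.comp U) (φ x) := fun x =>
    (IsSelfAdjoint.commute_cfcHom hT hT (commute_initial_projection hU hT hr).symm x).symm
  have habs : ∀ t, F t = 1 ∧ |2 * (t : ℝ) - 1| = 2 * (t : ℝ) - 1 ∨
      F t = -1 ∧ |2 * (t : ℝ) - 1| = -(2 * (t : ℝ) - 1) := fun t => by
    rcases hσ t with h | h
    · exact .inr ⟨if_neg (by linarith), abs_of_neg (by linarith)⟩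
    · exact .inl ⟨if_pos h, abs_of_pos (by linarith)⟩
  have hFabs : ∀ t, F t * (2 * (t : ℝ) - 1) = |2 * (t : ℝ) - 1| := fun t => by
    rcases habs t with ⟨h, h'⟩ | ⟨h, h'⟩ <;> rw [h, h'] <;> ring
  have main := matchedProjection_blockPullback_of_hom hV hU hQ₀ hUQ φ hφ (i := i) (F := F)
    (l := l) (g := g) (s := s) (k := k) (mul_initial_projection hU hlsa hll hr)
    (fun t => (habs t).imp And.left And.left) hl
    (by
      ext t
      exact inv_mul_cancel₀ (hne t))
    (by
      ext t
      change √(|2 * (t : ℝ) - 1|⁻¹) * √(|2 * (t : ℝ) - 1|⁻¹) * F t * (2 * (t : ℝ) - 1) = 1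
      rw [mul_assoc, hFabs, Real.mul_self_sqrt (by positivity),
        inv_mul_cancel₀ (abs_ne_zero.mpr (hne t))])
    (by
      ext t
      change ((2 * (t : ℝ) - 1) ^ 2 * (|2 * (t : ℝ) - 1| + 1))⁻¹ * (F t * (2 * (t : ℝ) - 1) + 1) =
        (2 * (t : ℝ) - 1)⁻¹ * (2 * (t : ℝ) - 1)⁻¹
      have h1 := hne t
      have h2 : |2 * (t : ℝ) - 1| + 1 ≠ 0 := by positivity
      rw [hFabs]
      field_simp)
  simpa only [map_neg, map_sub, map_add, map_one, map_zero, hi, hFφ, hlφ] using main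

end Main

end Adjointable

/-! ### Transfer to `H` along the unitary `U_P`. -/

theorem mainTheorem5 {A : Type*} [NonUnitalCStarAlgebra A] [PartialOrder A] [StarOrderedRing A]
    {H : Type*} [NormedAddCommGroup H] [NormedSpace ℂ H] [CompleteSpace H]
    [SMul A H] [CStarModule A H]
    (P Q : Adjointable A H H) (hPQ : P.IsHarmonious Q) (hP0 : P ≠ 0) (hP1 : P ≠ 1)
    (T : Adjointable A (P.idemRange hPQ.isStarProjection.isIdempotentElem)
      (P.idemRange hPQ.isStarProjection.isIdempotentElem))
    (U : Adjointable A (P.idemRange hPQ.isStarProjection.isIdempotentElem) P.nullSpace)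
    (Q₀ : Adjointable A P.nullSpace P.nullSpace)
    (hrep : P.IsCanonicalRep hPQ.isStarProjection Q T U Q₀) :
    ((P.decompUnitary hPQ.isStarProjection).comp Q.matchedProjection).comp
        (P.decompUnitary hPQ.isStarProjection).adj =
      Adjointable.block
        ((1 / 2 : ℂ) • (1 + T.signOp))
        0
        0
        ((1 / 2 : ℂ) • (U.comp (1 - T.signOp)).comp U.adj + Q₀) := by
  open Adjointable in
  set V := P.decompUnitary hPQ.isStarProjection with hVdef
  have hV' : ∀ x, V.adj (V x) = x := fun x => by
    rw [hVdef, decompUnitary_adj_apply, coe_decompUnitary_fst, coe_decompUnitary_snd]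
    abel
  have hV : ∀ x, V (V.adj x) = x := fun x => by
    obtain ⟨z, hz⟩ := x.1.2
    have hw : P (x.2 : H) = 0 := x.2.2
    have hPz : P (x.1 : H) = x.1 := by
      rw [← hz]
      exact apply_apply_of_idem hPQ.isStarProjection.isIdempotentElem z
    rw [hVdef, decompUnitary_adj_apply]
    refine Prod.ext (Subtype.ext ?_) (Subtype.ext ?_)
    · change P ((x.1 : H) + x.2) = x.1
      rw [map_add', hPz, hw, add_zero]
    · change ((x.1 : H) + x.2) - P (x.1 + x.2) = x.2
      rw [map_add', hPz, hw, add_zero, add_sub_cancel_left]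
  have hQ : Q = blockPullback V U Q₀ T (-T.ell) T.ell (1 - T) 1 := by
    have hneg : (-T.ell).comp U.adj = -(T.ell.comp U.adj) := rfl
    rw [blockPullback_one, hneg, ← hrep.block_eq]
    ext x
    change Q x = V.adj (V (Q (V.adj (V x))))
    rw [hV', hV']
  have hm := matchedProjection_blockPullback hV hrep.partialIsometry hrep.isStarProjection
    hrep.adj_comp_eq_zero hrep.isSelfAdjoint hrep.nonneg hrep.range_adj
  rw [← hQ] at hm
  rw [hm]
  ext x
  change V ((1 / 2 : ℂ) • blockPullback V U Q₀ _ _ _ _ _ (V.adj x)) = _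
  rw [map_smul', blockPullback_apply, hV, hV]
  refine Prod.ext ?_ ?_
  · change (1 / 2 : ℂ) • ((1 + T.signOp) _ + 0) = (1 / 2 : ℂ) • (1 + T.signOp) _ + 0
    rw [add_zero, add_zero]
  -- The scalar 2 on `Q₀` cancels the global factor 1/2, so `Q₀` appears with coefficient 1.
  · change (1 / 2 : ℂ) • (U 0 + (U ((1 - T.signOp) (U.adj _)) + (2 : ℂ) • Q₀ _)) =
      0 + ((1 / 2 : ℂ) • U ((1 - T.signOp) (U.adj _)) + Q₀ _)
    rw [map_zero', zero_add, zero_add, smul_add, smul_smul]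
    norm_num
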